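/- Consider simple graphs $G=(V,E)$ on $V=\{1,\dots,n\}$ with a known degree bound $d$, given by their incidence lists: a query $(v,i)$ with $v\in V$ and $1\le i\le d$ returns the $i$-th neighbor of $v$, or a special symbol if $v$ has fewer than $i$ neighbors. A (randomized) \emph{local sparse spanning graph algorithm} with parameters $n,\varepsilon,\delta$ for connected graphs with degree bound $d$ answers, on input an edge $\{u,v\}\in E$ and after making adaptive queries to the incidence lists of $G$, whether $\{u,v\}\in E'$, where $E'\subseteq E$ is an edge set that is determined by $G$ and the internal randomness of the algorithm (the same randomness is used for all input edges), such that for every connected graph $G$ with $n$ vertices and degree bound $d$ the graph $G'=(V,E')$ is connected with probability $1$, and $|E'|\le(1+\varepsilon)n$ with probability at least $1-\delta$. \textbf{Theorem.} Every local sparse spanning graph algorithm has query complexity $\Omega(\sqrt n)$, even for connected graphs with a constant degree bound $d$ and for constants $\varepsilon\ge 0$ and $0\le\delta<1/3$, whenever $1+\varepsilon<d/2$ (that is, whenever the bound $(1+\varepsilon)n$ is below the number $dn/2$ of edges of a $d$-regular graph). Precisely: for all such $d,\varepsilon,\delta$ there are $c>0$ and $n_0$ such that for every $n\ge n_0$ and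 every local sparse spanning graph algorithm with parameters $n,\varepsilon,\delta$ for connected graphs with degree bound $d$, if for every such graph and every edge of it the algorithm makes at most $q$ queries with probability $1$, then $q\ge c\sqrt n$. -/

import Mathlib

/-- A simple graph on the vertex set `Fin n` with degree bound `d`, given by its incidence lists:
`nbr v i` is the `i`-th neighbour of `v`, and it is `none` (the special symbol) if `v` has too few
neighbours. Every neighbour of `v` occurs exactly once in the list of `v`, in an arbitrary order,
and the `none` entries come last. In particular every degree is at most `d`. -/
structure IncidenceGraph (n d : ℕ) where
  /-- the underlying graph -/
  graph : SimpleGraph (Fin n)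
  /-- the incidence lists -/
  nbr : Fin n → Fin d → Option (Fin n)
  adj_iff : ∀ v w, graph.Adj v w ↔ ∃ i, nbr v i = some w
  nbr_injective : ∀ v w i j, nbr v i = some w → nbr v j = some w → i = j
  nbr_packed : ∀ v i j, i ≤ j → nbr v i = none → nbr v j = none

/-- A deterministic adaptive query procedure: it either stops with a yes/no answer, or it asks for
the `i`-th neighbour of a vertex `v` and continues depending on the reply. Any vertex may be
queried at any time, and every path of the tree is finite. -/
inductive QueryTree (n d : ℕ) where
  | answer (b : Bool) : QueryTree n d
  | query (v : Fin n) (i : Fin d) (next : Option (Fin n) → QueryTree n d) : QueryTree n d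

namespace QueryTree

/-- The answer of the procedure when its queries are answered from the incidence lists `N`. -/
def run {n d : ℕ} (N : Fin n → Fin d → Option (Fin n)) : QueryTree n d → Bool
  | answer b => b
  | query v i next => run N (next (N v i))

/-- The number of queries made when the queries are answered from the incidence lists `N`. -/
def cost {n d : ℕ} (N : Fin n → Fin d → Option (Fin n)) : QueryTree n d → ℕ
  | answer _ => 0
  | query v i next => cost N (next (N v i)) + 1

end QueryTree

/-- A randomized local algorithm for graphs with `n` vertices and degree bound `d`. A point of `Ω`
is an outcome of the internal (public, unbounded) randomness, shared by all invocations. For each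
outcome and each input edge the algorithm is a deterministic adaptive query procedure. -/
structure LocalAlgorithm (Ω : Type*) [MeasurableSpace Ω] (n d : ℕ) where
  /-- the procedure executed on an input edge, for a given outcome of the coins -/
  proc : Ω → Sym2 (Fin n) → QueryTree n d
  /-- "the algorithm answers yes" is an event -/
  measurableSet_yes : ∀ (e : Sym2 (Fin n)) (G : IncidenceGraph n d),
    MeasurableSet {ω | (proc ω e).run G.nbr = true}

namespace LocalAlgorithm

variable {Ω : Type*} [MeasurableSpace Ω] {n d : ℕ}

/-- The subgraph `G' = (V, E')` to which the algorithm gives access: `E'` consists of the edges of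
`G` that are answered positively. It is determined by `G` and the internal randomness. -/
def subgraph (A : LocalAlgorithm Ω n d) (G : IncidenceGraph n d) (ω : Ω) :
    SimpleGraph (Fin n) :=
  SimpleGraph.fromEdgeSet {e | e ∈ G.graph.edgeSet ∧ (A.proc ω e).run G.nbr = true}

/-- `A` is a local sparse spanning graph algorithm with respect to the class `C`, with sparsity
parameter `ε` and failure probability `δ`: on every graph of the class, `G'` is connected with
probability `1`, and it has at most `(1 + ε) n` edges with probability at least `1 - δ`. -/
def IsLocalSparseSpanning (A : LocalAlgorithm Ω n d) (μ : MeasureTheory.Measure Ω)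
    (C : Set (IncidenceGraph n d)) (ε δ : ℝ) : Prop :=
  ∀ G ∈ C,
    (∀ᵐ ω ∂μ, (A.subgraph G ω).Connected) ∧
    1 - δ ≤ μ.real {ω | ((A.subgraph G ω).edgeSet.ncard : ℝ) ≤ (1 + ε) * n}

/-- `A` has query complexity at most `q` on the class `C`: on every graph of the class and every
edge of it, the algorithm almost surely makes at most `q` queries. -/
def QueryComplexityAtMost (A : LocalAlgorithm Ω n d) (μ : MeasureTheory.Measure Ω)
    (C : Set (IncidenceGraph n d)) (q : ℕ) : Prop :=
  ∀ G ∈ C, ∀ e ∈ G.graph.edgeSet, ∀ᵐ ω ∂μ, (A.proc ω e).cost G.nbr ≤ q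

end LocalAlgorithm

/-- The connected graphs with `n` vertices and degree bound `d`. -/
def connectedGraphs (n d : ℕ) : Set (IncidenceGraph n d) := {G | G.graph.Connected}

/-! Fix an outcome of the coins for which every connected graph gets a connected subgraph. Suppose
the lists read while deciding an edge `u v` also occur in a connected graph in which `u v` is a
bridge. The run there is the same, so the answer has to be yes (`run_eq_true_of_separated`). Such a
graph exists when some cut between `u` and `v` is crossed by no explored edge other than `u v`, and
every unexplored vertex has at most one explored neighbour: drop all edges between unexplored
vertices and run one path through the unexplored vertices on each side of the cut
(`Separated.exists_bridge`). This uses at most three incidences per unexplored vertex, and `1 + ε <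
d / 2` forces `3 ≤ d`.

Exploration rarely destroys this condition on a uniformly random connected graph with nearly `d n /
2` edges. Conditioned on the explored lists, a prescribed edge `x y` between unexplored vertices, at
prescribed list positions, has probability at most `1 / M` with `M` of order `n`: exchanging it with
another edge leads injectively to at least `M` times as many graphs (`mul_card_filter_nbr_le`),
since one of the two exchanges preserves connectivity (`Connected.switch`). So a fresh vertex is
adjacent to an unexplored neighbour of the explored set with probability at most `q d³ / M`, and by
a birthday-type union bound `q` queries reveal a non-bridge with probability at most `q² d³ / M`
(`card_filter_not_separated_visited_le`).

Averaging over the coins, some outcome is sparse on at least two thirds of these graphs and hence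
rejects a linear number of edges in each of them. Thus `q² / n` is bounded below. -/

namespace SimpleGraph

/-! ### Connectivity: closed sets, edge exchanges, paths -/

variable {V : Type*} {G : SimpleGraph V}

theorem Connected.mem_of_closed (h : G.Connected) {A : Set V}
    (hA : ∀ v w, G.Adj v w → v ∈ A → w ∈ A) {v w : V} (hv : v ∈ A) : w ∈ A := by
  obtain ⟨p⟩ := h.preconnected v w
  induction p with
  | nil => exact hv
  | cons hadj _ ih => exact ih (hA _ _ hadj hv)

theorem connected_of_closed [Nonempty V]
    (h : ∀ A : Set V, (∀ v w, G.Adj v w → v ∈ A → w ∈ A) → ∀ v w, v ∈ A → w ∈ A) :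
    G.Connected := by
  refine (connected_iff _).2 ⟨fun v w => ?_, inferInstance⟩
  exact h {z | G.Reachable v z} (fun a b hab ha => Reachable.trans ha hab.reachable) v w
    (Reachable.refl v)

theorem exists_closed_of_not_connected [Nonempty V] (h : ¬ G.Connected) :
    ∃ A : Set V, (∀ v w, G.Adj v w → (v ∈ A ↔ w ∈ A)) ∧ (∃ v, v ∈ A) ∧ ∃ w, w ∉ A := by
  by_contra! hc
  refine h (connected_of_closed fun A hA v w hv => ?_)
  exact hc A (fun a b hab => ⟨hA a b hab, hA b a hab.symm⟩) ⟨v, hv⟩ w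

/-- Of the two ways to exchange the ends of two edges, one preserves connectivity. -/
theorem Connected.switch (h : G.Connected) {x y a b : V} {G₁ G₂ : SimpleGraph V}
    (h₁ : ∀ v w, G.Adj v w → s(v, w) ≠ s(x, y) → s(v, w) ≠ s(a, b) → G₁.Adj v w)
    (h₂ : ∀ v w, G.Adj v w → s(v, w) ≠ s(x, y) → s(v, w) ≠ s(a, b) → G₂.Adj v w)
    (hxa : G₁.Adj x a) (hyb : G₁.Adj y b) (hxb : G₂.Adj x b) (hya : G₂.Adj y a) :
    G₁.Connected ∨ G₂.Connected := by
  have := h.nonempty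
  by_contra! hc
  obtain ⟨A, hA, ⟨p, hp⟩, r, hr⟩ := exists_closed_of_not_connected hc.1
  obtain ⟨B, hB, ⟨s, hs⟩, t, ht⟩ := exists_closed_of_not_connected hc.2
  have key : ∀ (P : Set V), (∀ v w, G.Adj v w → (v ∈ P ↔ w ∈ P)) → ∀ v w, v ∈ P → w ∈ P :=
    fun P hP v w hv => h.mem_of_closed (fun v w hvw => (hP v w hvw).1) hv
  have e1 := hA _ _ hxa
  have e2 := hA _ _ hyb
  have e3 := hB _ _ hxb
  have e4 := hB _ _ hya
  have closed : ∀ P : Set V, (x ∈ P ↔ y ∈ P) → (a ∈ P ↔ b ∈ P) →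
      (∀ v w, G.Adj v w → s(v, w) ≠ s(x, y) → s(v, w) ≠ s(a, b) → (v ∈ P ↔ w ∈ P)) →
      ∀ v w, v ∈ P → w ∈ P := by
    intro P hxy hab hP
    refine key P fun v w hvw => ?_
    by_cases c1 : s(v, w) = s(x, y)
    · rcases Sym2.eq_iff.1 c1 with ⟨rfl, rfl⟩ | ⟨rfl, rfl⟩
      · exact hxy
      · exact hxy.symm
    by_cases c2 : s(v, w) = s(a, b)
    · rcases Sym2.eq_iff.1 c2 with ⟨rfl, rfl⟩ | ⟨rfl, rfl⟩
      · exact hab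
      · exact hab.symm
    exact hP v w hvw c1 c2
  have nA : ¬ (x ∈ A ↔ y ∈ A) := fun hxy =>
    hr (closed A hxy (e1.symm.trans (hxy.trans e2))
      (fun v w k k1 k2 => hA _ _ (h₁ v w k k1 k2)) p r hp)
  have nB : ¬ (x ∈ B ↔ y ∈ B) := fun hxy =>
    ht (closed B hxy (e4.symm.trans (hxy.symm.trans e3))
      (fun v w k k1 k2 => hB _ _ (h₂ v w k k1 k2)) s t hs)
  -- Both cuts separate `x` from `y`, so their symmetric difference does not, and likewise for `a`,
  -- `b`. Thus no edge of `G` crosses it. But it separates `x` from `a`, which agree on `A` and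
  -- differ on `B`.
  have hcl := closed {z | z ∈ A ↔ z ∈ B}
    (by simp only [Set.mem_ofPred_eq]; clear closed key h₁ h₂ hA hB; grind)
    (by simp only [Set.mem_ofPred_eq]; clear closed key h₁ h₂ hA hB; grind)
    (fun v w k k1 k2 => iff_congr (hA _ _ (h₁ v w k k1 k2)) (hB _ _ (h₂ v w k k1 k2)))
  have h5 := hcl x a
  have h6 := hcl a x
  simp only [Set.mem_ofPred_eq] at h5 h6
  clear closed key h₁ h₂ hA hB hcl
  grind

/-- Every finite set of vertices carries a path. -/
theorem exists_path_on {V : Type*} [DecidableEq V] (P : Finset V) :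
    ∃ H : SimpleGraph V, (∀ v w, H.Adj v w → v ∈ P ∧ w ∈ P) ∧
      (∀ v, ∃ a b : V, ∀ w, H.Adj v w → w = a ∨ w = b) ∧
      ∀ A : Set V, (∀ v w, H.Adj v w → v ∈ A → w ∈ A) → ∀ v ∈ P, ∀ w ∈ P, v ∈ A → w ∈ A := by
  classical
  let f : P ≃ Fin P.card := P.equivFin
  let H : SimpleGraph V := (pathGraph P.card).map
    (f.symm.toEmbedding.trans (Function.Embedding.subtype _))
  have hadj : ∀ i j : Fin P.card, (pathGraph P.card).Adj i j →
      H.Adj (f.symm i : V) (f.symm j : V) := by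
    intro i j hij
    exact (map_adj _ _ _ _).2 ⟨i, j, hij, rfl, rfl⟩
  refine ⟨H, ?_, ?_, ?_⟩
  · intro v w hvw
    obtain ⟨i, j, -, rfl, rfl⟩ := (map_adj _ _ _ _).1 hvw
    exact ⟨(f.symm i).2, (f.symm j).2⟩
  · intro v
    by_cases hv : v ∈ P
    · let i := f ⟨v, hv⟩
      -- Only an upper bound on the neighbours is needed, so the default `v` past the end and the
      -- truncated `0 - 1` at the start are harmless.
      let g : ℕ → V := fun k => if hk : k < P.card then (f.symm ⟨k, hk⟩ : V) else v
      refine ⟨g (i.val + 1), g (i.val - 1), fun w hw => ?_⟩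
      obtain ⟨i', j, hij, h1, rfl⟩ := (map_adj _ _ _ _).1 hw
      have hi : i' = i := by
        apply f.symm.injective
        apply Subtype.ext
        simpa [i] using h1
      subst hi
      have hg : g j.val = (f.symm j : V) := by simp [g]
      rcases pathGraph_adj.1 hij with h | h
      · left
        rw [h, hg]; rfl
      · right
        rw [← h, Nat.add_sub_cancel, hg]; rfl
    · refine ⟨v, v, fun w hw => ?_⟩
      obtain ⟨i', j, hij, h1, rfl⟩ := (map_adj _ _ _ _).1 hw
      exact absurd (h1 ▸ (f.symm i').2) hv
  · intro A hA v hv w hw hvA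
    obtain ⟨m, hm⟩ : ∃ m, P.card = m + 1 :=
      Nat.exists_eq_succ_of_ne_zero (Finset.card_ne_zero_of_mem hv)
    have hc : (pathGraph P.card).Connected := by
      rw [hm]; exact pathGraph_connected m
    have := hc.mem_of_closed (A := {i | (f.symm i : V) ∈ A})
      (fun i j hij hi => hA _ _ (hadj i j hij) hi) (v := f ⟨v, hv⟩) (w := f ⟨w, hw⟩) (by simpa)
    simpa using this

end SimpleGraph

/-! ### Incidence lists and dart counts -/

/-- The list `l` enumerates the set `s` without repetitions, with the blanks at the end. -/
structure IsIncidenceList {n d : ℕ} (s : Set (Fin n)) (l : Fin d → Option (Fin n)) : Prop where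
  mem_iff : ∀ w, w ∈ s ↔ ∃ i, l i = some w
  injective : ∀ w i j, l i = some w → l j = some w → i = j
  packed : ∀ i j, i ≤ j → l i = none → l j = none

theorem exists_isIncidenceList {n d : ℕ} (s : Finset (Fin n)) (h : s.card ≤ d) :
    ∃ l : Fin d → Option (Fin n), IsIncidenceList (s : Set (Fin n)) l := by
  refine ⟨fun i => s.toList[(i : ℕ)]?, ?_, ?_, ?_⟩
  · intro w
    rw [Finset.mem_coe, ← Finset.mem_toList, List.mem_iff_getElem?]
    constructor
    · rintro ⟨i, hi⟩
      have : i < s.toList.length := (List.getElem?_eq_some_iff.1 hi).1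
      exact ⟨⟨i, by rw [Finset.length_toList] at this; omega⟩, hi⟩
    · rintro ⟨i, hi⟩
      exact ⟨i, hi⟩
  · intro w i j hi hj
    have hlt : (i : ℕ) < s.toList.length := (List.getElem?_eq_some_iff.1 hi).1
    exact Fin.ext ((List.getElem?_inj hlt s.nodup_toList).1 (hi.trans hj.symm))
  · intro i j hij hi
    rw [List.getElem?_eq_none_iff] at hi ⊢
    exact hi.trans hij

namespace IncidenceGraph

variable {n d : ℕ}

theorem isIncidenceList (G : IncidenceGraph n d) (v : Fin n) :
    IsIncidenceList {w | G.graph.Adj v w} (G.nbr v) :=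
  ⟨G.adj_iff v, G.nbr_injective v, G.nbr_packed v⟩

theorem exists_of_isIncidenceList (H : SimpleGraph (Fin n))
    (h : ∀ v, ∃ l : Fin d → Option (Fin n), IsIncidenceList {w | H.Adj v w} l) :
    ∃ G : IncidenceGraph n d, G.graph = H := by
  choose N hN using h
  exact ⟨⟨H, N, fun v => (hN v).mem_iff, fun v => (hN v).injective, fun v => (hN v).packed⟩, rfl⟩

theorem exists_of_isIncidenceList_of_eq (H : SimpleGraph (Fin n)) (Q : Finset (Fin n))
    (N : Fin n → Fin d → Option (Fin n))
    (hQ : ∀ v ∈ Q, IsIncidenceList {w | H.Adj v w} (N v))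
    (h : ∀ v ∉ Q, ∃ l : Fin d → Option (Fin n), IsIncidenceList {w | H.Adj v w} l) :
    ∃ G : IncidenceGraph n d, G.graph = H ∧ ∀ v ∈ Q, G.nbr v = N v := by
  have h' : ∀ v, ∃ l : Fin d → Option (Fin n), IsIncidenceList {w | H.Adj v w} l ∧
      (v ∈ Q → l = N v) := by
    intro v
    by_cases hv : v ∈ Q
    · exact ⟨N v, hQ v hv, fun _ => rfl⟩
    · obtain ⟨l, hl⟩ := h v hv
      exact ⟨l, hl, fun h => absurd h hv⟩
  choose N' hN hN' using h'
  exact ⟨⟨H, N', fun v => (hN v).mem_iff, fun v => (hN v).injective,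
    fun v => (hN v).packed⟩, rfl, hN'⟩

theorem nbr_inj {G G' : IncidenceGraph n d} (h : G.nbr = G'.nbr) : G = G' := by
  have hg : G.graph = G'.graph := by
    ext v w
    rw [G.adj_iff, G'.adj_iff, h]
  cases G
  cases G'
  simp only at h hg
  subst h hg
  rfl

/-- Finiteness permits counting graphs, and lets one outcome of the coins be good for all of them
simultaneously. -/
noncomputable instance : Fintype (IncidenceGraph n d) :=
  @Fintype.ofFinite _ (Finite.of_injective IncidenceGraph.nbr fun _ _ => nbr_inj)

noncomputable instance : DecidableEq (IncidenceGraph n d) := Classical.decEq _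

open Classical in
/-- The ordered pairs of adjacent vertices. -/
noncomputable def darts (G : IncidenceGraph n d) : Finset (Fin n × Fin n) :=
  {p | G.graph.Adj p.1 p.2}

@[simp]
theorem mem_darts {G : IncidenceGraph n d} {p : Fin n × Fin n} :
    p ∈ G.darts ↔ G.graph.Adj p.1 p.2 := by
  simp [darts]

open Classical in
/-- The neighbours of a vertex. -/
noncomputable def neighbors (G : IncidenceGraph n d) (v : Fin n) : Finset (Fin n) :=
  {w | G.graph.Adj v w}

@[simp]
theorem mem_neighbors {G : IncidenceGraph n d} {v w : Fin n} :
    w ∈ G.neighbors v ↔ G.graph.Adj v w := by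
  simp [neighbors]

theorem card_neighbors_le (G : IncidenceGraph n d) (v : Fin n) : (G.neighbors v).card ≤ d := by
  have h : ∀ w ∈ G.neighbors v, ∃ i ∈ (Finset.univ : Finset (Fin d)), G.nbr v i = some w := by
    intro w hw
    obtain ⟨i, hi⟩ := (G.adj_iff v w).1 (mem_neighbors.1 hw)
    exact ⟨i, Finset.mem_univ i, hi⟩
  have := Finset.card_le_card_of_forall_subsingleton (fun w i => G.nbr v i = some w) h
    (fun i _ w hw w' hw' => Option.some.inj (hw.2.symm.trans hw'.2))
  simpa using this

theorem card_darts_filter_fst_mem_le (G : IncidenceGraph n d) (W : Finset (Fin n)) :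
    (G.darts.filter (fun p => p.1 ∈ W)).card ≤ W.card * d := by
  have h : G.darts.filter (fun p => p.1 ∈ W) ⊆
      (W.sigma fun v => G.neighbors v).image (fun p => (p.1, p.2)) := by
    intro p hp
    simp only [Finset.mem_filter, mem_darts] at hp
    simp only [Finset.mem_image, Finset.mem_sigma, mem_neighbors]
    exact ⟨⟨p.1, p.2⟩, ⟨hp.2, hp.1⟩, rfl⟩
  refine (Finset.card_le_card h).trans (Finset.card_image_le.trans ?_)
  rw [Finset.card_sigma]
  exact Finset.sum_le_card_nsmul _ _ _ fun v _ => G.card_neighbors_le v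

theorem card_darts_le (G : IncidenceGraph n d) : G.darts.card ≤ n * d := by
  simpa using G.card_darts_filter_fst_mem_le Finset.univ

theorem card_filter_swap_darts (G : IncidenceGraph n d) (P : Fin n × Fin n → Prop)
    [DecidablePred P] :
    (G.darts.filter (fun p => P p.swap)).card = (G.darts.filter P).card := by
  refine Finset.card_bij (fun p _ => p.swap) ?_ (fun p _ q _ h => Prod.swap_injective h) ?_
  · intro p hp
    simp only [Finset.mem_filter, mem_darts, Prod.fst_swap, Prod.snd_swap] at hp ⊢
    exact ⟨hp.1.symm, hp.2⟩
  · intro p hp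
    simp only [Finset.mem_filter, mem_darts] at hp
    exact ⟨p.swap, by simpa using ⟨hp.1.symm, hp.2⟩, Prod.swap_swap p⟩

/-! ### Switching two edges -/

/-- The permutation of the vertices that acts on the list of `v` when the edges `x y` and `a b`
are replaced by `x a` and `y b`. -/
def switchPerm (x y a b v : Fin n) : Equiv.Perm (Fin n) :=
  if v = x then Equiv.swap y a else if v = y then Equiv.swap x b
  else if v = a then Equiv.swap x b else if v = b then Equiv.swap y a else 1

theorem switchPerm_apply (x y a b v w : Fin n) : switchPerm x y a b v w =
    if v = x then (if w = y then a else if w = a then y else w)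
    else if v = y then (if w = x then b else if w = b then x else w)
    else if v = a then (if w = x then b else if w = b then x else w)
    else if v = b then (if w = y then a else if w = a then y else w) else w := by
  unfold switchPerm
  split_ifs <;> simp_all [Equiv.swap_apply_def]

/-- The edges `x y` and `a b` can be replaced by `x a` and `y b`. -/
structure Switchable (G : IncidenceGraph n d) (x y a b : Fin n) : Prop where
  adj_xy : G.graph.Adj x y
  adj_ab : G.graph.Adj a b
  nadj_xa : ¬ G.graph.Adj x a
  nadj_yb : ¬ G.graph.Adj y b
  ne_xa : x ≠ a
  ne_xb : x ≠ b
  ne_ya : y ≠ a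
  ne_yb : y ≠ b

/-- Symmetry of the switched adjacency relation. The nonadjacency and distinctness conditions ensure
that the swaps exchange an edge with a non-edge at each of the four endpoints. -/
theorem Switchable.adj_switchPerm_iff {G : IncidenceGraph n d} {x y a b : Fin n}
    (h : G.Switchable x y a b) (v w : Fin n) :
    G.graph.Adj v (switchPerm x y a b v w) ↔ G.graph.Adj w (switchPerm x y a b w v) := by
  obtain ⟨h1, h2, h3, h4, h5, h6, h7, h8⟩ := h
  have hxy := h1.ne
  have hab := h2.ne
  have hs : ∀ p q, G.graph.Adj p q ↔ G.graph.Adj q p := fun p q => G.graph.adj_comm p q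
  have hl : ∀ p, ¬ G.graph.Adj p p := fun p => G.graph.irrefl
  simp only [switchPerm_apply]
  by_cases vx : v = x
  · subst vx
    by_cases wx : w = v
    · subst wx; rfl
    by_cases wy : w = y
    · subst wy; grind
    by_cases wa : w = a
    · subst wa; grind
    by_cases wb : w = b
    · subst wb; grind
    grind
  by_cases vy : v = y
  · subst vy
    grind
  by_cases va : v = a
  · subst va
    grind
  by_cases vb : v = b
  · subst vb
    grind
  grind

theorem switchPerm_involutive (x y a b v : Fin n) (w : Fin n) :
    switchPerm x y a b v (switchPerm x y a b v w) = w := by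
  unfold switchPerm
  split_ifs <;> simp

/-- Entries are relabelled in place, so list positions survive. This is what later makes a switch
reversible from its result. -/
theorem Switchable.exists_switch {G : IncidenceGraph n d} {x y a b : Fin n}
    (h : G.Switchable x y a b) :
    ∃ G' : IncidenceGraph n d,
      (∀ v i, G'.nbr v i = (G.nbr v i).map (switchPerm x y a b v)) ∧
      ∀ v w, G'.graph.Adj v w ↔ G.graph.Adj v (switchPerm x y a b v w) := by
  have hinv := switchPerm_involutive x y a b
  refine ⟨⟨⟨fun v w => G.graph.Adj v (switchPerm x y a b v w), ⟨?_⟩, ⟨?_⟩⟩,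
    fun v i => (G.nbr v i).map (switchPerm x y a b v), ?_, ?_, ?_⟩, fun _ _ => rfl,
    fun _ _ => Iff.rfl⟩
  · intro v w hvw
    exact (h.adj_switchPerm_iff v w).1 hvw
  · intro v hv
    obtain ⟨h1, h2, h3, h4, h5, h6, h7, h8⟩ := h
    have hxy := h1.ne
    have hab := h2.ne
    have hl : ∀ p, ¬ G.graph.Adj p p := fun p => G.graph.irrefl
    simp only [switchPerm_apply] at hv
    grind
  · intro v w
    rw [G.adj_iff]
    refine exists_congr fun i => ?_
    rw [Option.map_eq_some_iff]
    constructor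
    · intro hi
      exact ⟨_, hi, hinv v w⟩
    · rintro ⟨z, hz, rfl⟩
      rw [hinv, hz]
  · intro v w i j hi hj
    rw [Option.map_eq_some_iff] at hi hj
    obtain ⟨z, hz, rfl⟩ := hi
    obtain ⟨z', hz', he⟩ := hj
    rw [(switchPerm x y a b v).injective he] at hz'
    exact G.nbr_injective v z i j hz hz'
  · intro v i j hij hi
    rw [Option.map_eq_none_iff] at hi ⊢
    exact G.nbr_packed v i j hij hi

theorem card_darts_eq_of_adj_iff {G G' : IncidenceGraph n d} {x y a b : Fin n}
    (h : ∀ v w, G'.graph.Adj v w ↔ G.graph.Adj v (switchPerm x y a b v w)) :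
    G'.darts.card = G.darts.card := by
  refine Finset.card_bij (fun p _ => (p.1, switchPerm x y a b p.1 p.2)) ?_ ?_ ?_
  · intro p hp
    exact mem_darts.2 ((h _ _).1 (mem_darts.1 hp))
  · rintro ⟨p1, p2⟩ _ ⟨q1, q2⟩ _ he
    obtain ⟨e1, e2⟩ := Prod.mk.inj he
    simp only at e1 e2
    subst e1
    rw [(switchPerm x y a b p1).injective e2]
  · rintro ⟨p1, p2⟩ hp
    refine ⟨(p1, switchPerm x y a b p1 p2), ?_, ?_⟩
    · rw [mem_darts, h]
      simpa [switchPerm_involutive] using hp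
    · simp [switchPerm_involutive]

theorem Switchable.adj_of_adj {G G' : IncidenceGraph n d} {x y a b : Fin n}
    (hs : G.Switchable x y a b)
    (h : ∀ v w, G'.graph.Adj v w ↔ G.graph.Adj v (switchPerm x y a b v w)) :
    G'.graph.Adj x a ∧ G'.graph.Adj y b ∧
      ∀ v w, G.graph.Adj v w → s(v, w) ≠ s(x, y) → s(v, w) ≠ s(a, b) → G'.graph.Adj v w := by
  obtain ⟨h1, h2, h3, h4, h5, h6, h7, h8⟩ := hs
  have hxy := h1.ne
  have hab := h2.ne
  have hc : ∀ p q, G.graph.Adj p q ↔ G.graph.Adj q p := fun p q => G.graph.adj_comm p q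
  refine ⟨?_, ?_, ?_⟩
  · rw [h]; simp only [switchPerm_apply]; grind
  · rw [h]; simp only [switchPerm_apply]; grind
  · intro v w hvw e1 e2
    rw [h]
    simp only [ne_eq, Sym2.eq_iff] at e1 e2
    simp only [switchPerm_apply]
    grind

end IncidenceGraph

/-! ### Explored vertices of a query procedure -/

namespace QueryTree

variable {n d : ℕ}

/-- The vertices whose incidence lists are queried. -/
def visited (N : Fin n → Fin d → Option (Fin n)) : QueryTree n d → Finset (Fin n)
  | answer _ => ∅
  | query v i next => insert v (visited N (next (N v i)))

theorem run_congr {N N' : Fin n → Fin d → Option (Fin n)} (T : QueryTree n d)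
    (h : ∀ v ∈ T.visited N, N' v = N v) : T.run N' = T.run N := by
  induction T with
  | answer b => rfl
  | query v i next ih =>
    simp only [visited, Finset.mem_insert, forall_eq_or_imp] at h
    simp only [run, h.1]
    exact ih _ h.2

end QueryTree

/-! ### Explorations compatible with a bridge -/

namespace IncidenceGraph

variable {n d : ℕ}

/-- The incidence lists of the vertices of `Q` are consistent with `u v` being a bridge. -/
structure Separated (G : IncidenceGraph n d) (u v : Fin n) (Q : Finset (Fin n)) : Prop where
  unique : ∀ y ∉ Q, ∀ z ∈ Q, ∀ z' ∈ Q, G.graph.Adj z y → G.graph.Adj z' y → z = z'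
  exists_cut : ∃ A : Set (Fin n), u ∈ A ∧ v ∉ A ∧
    ∀ x ∈ Q, ∀ y, G.graph.Adj x y → s(x, y) ≠ s(u, v) → (x ∈ A ↔ y ∈ A)

theorem separated_singleton (G : IncidenceGraph n d) {u v : Fin n} (huv : u ≠ v) :
    G.Separated u v {u} where
  unique := by simp
  exists_cut := by
    refine ⟨{w | w ≠ v}, huv, by simp, fun x hx y hxy hne => ?_⟩
    rw [Finset.mem_singleton] at hx
    subst hx
    have : y ≠ v := by rintro rfl; exact hne rfl
    simp [huv, this]

theorem Separated.congr {G G' : IncidenceGraph n d} {u v : Fin n} {Q : Finset (Fin n)}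
    (h : G.Separated u v Q) (hN : ∀ z ∈ Q, G'.nbr z = G.nbr z) : G'.Separated u v Q := by
  have ha : ∀ z ∈ Q, ∀ w, G'.graph.Adj z w ↔ G.graph.Adj z w := by
    intro z hz w
    rw [G.adj_iff, G'.adj_iff, hN z hz]
  obtain ⟨h1, A, hu, hv, hA⟩ := h
  exact ⟨fun y hy z hz z' hz' k k' => h1 y hy z hz z' hz' ((ha z hz y).1 k) ((ha z' hz' y).1 k'),
    A, hu, hv, fun x hx y k => hA x hx y ((ha x hx y).1 k)⟩

/-- The unexplored neighbours of `x` have no explored neighbour, so no earlier edge constrains their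
side of the cut, and they can all be moved to the side of `x`. The vertex `v` does not move, since
if unexplored it is a neighbour of the explored `u`. -/
theorem Separated.insert {G : IncidenceGraph n d} {u v : Fin n} {Q : Finset (Fin n)}
    (h : G.Separated u v Q) (huv : G.graph.Adj u v) (hu : u ∈ Q) {x : Fin n} (hx : x ∉ Q)
    (hnew : ∀ y ∉ Q, G.graph.Adj x y → ∀ z ∈ Q, ¬ G.graph.Adj z y) :
    G.Separated u v (insert x Q) := by
  classical
  obtain ⟨h1, A, hA1, hA2, hA⟩ := h
  refine ⟨?_, {w | if w ∉ Q ∧ G.graph.Adj x w then x ∈ A else w ∈ A}, ?_, ?_, ?_⟩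
  · intro y hy z hz z' hz' k k'
    rw [Finset.mem_insert] at hy hz hz'
    push Not at hy
    rcases hz with rfl | hz <;> rcases hz' with rfl | hz'
    · rfl
    · exact absurd k' (hnew y hy.2 k z' hz')
    · exact absurd k (hnew y hy.2 k' z hz)
    · exact h1 y hy.2 z hz z' hz' k k'
  · simp [hu, hA1]
  · have : ¬ (v ∉ Q ∧ G.graph.Adj x v) := fun hv => hnew v hv.1 hv.2 u hu huv
    simp [this, hA2]
  · intro z hz y hzy hne
    simp only [Set.mem_ofPred_eq]
    rcases Finset.mem_insert.1 hz with rfl | hz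
    · rw [if_neg (fun hc => G.graph.irrefl hc.2)]
      by_cases hy : y ∈ Q
      · rw [if_neg (fun hc => hc.1 hy)]
        exact (hA y hy z hzy.symm (by rwa [Sym2.eq_swap])).symm
      · rw [if_pos ⟨hy, hzy⟩]
    · rw [if_neg (fun hc => hc.1 hz), if_neg (fun hc => hnew y hc.1 hc.2 z hz hzy)]
      exact hA z hz y hzy hne

/-- If the lists of the vertices of `Q` are consistent with `u v` being a bridge, then there is
a connected graph with these lists in which `u v` is a bridge. -/
theorem Separated.exists_bridge {G : IncidenceGraph n d} (hd : 3 ≤ d) {u v : Fin n}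
    {Q : Finset (Fin n)} (h : G.Separated u v Q) (hu : u ∈ Q) (huv : G.graph.Adj u v)
    (hG : (G.graph.deleteEdges {s(u, v)}).Connected) :
    ∃ G' : IncidenceGraph n d, G'.graph.Connected ∧ (∀ z ∈ Q, G'.nbr z = G.nbr z) ∧
      ∃ A : Set (Fin n), u ∈ A ∧ v ∉ A ∧
        ∀ x y, G'.graph.Adj x y → s(x, y) ≠ s(u, v) → x ∈ A → y ∈ A := by
  classical
  obtain ⟨h1, A, hA1, hA2, hA⟩ := h
  have hGc : G.graph.Connected := hG.mono (SimpleGraph.deleteEdges_le _)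
  have hGe : ∀ B : Set (Fin n), (∀ x y, G.graph.Adj x y → s(x, y) ≠ s(u, v) → x ∈ B → y ∈ B) →
      ∀ x y, x ∈ B → y ∈ B := by
    intro B hB x y hx
    refine hG.mem_of_closed (fun a b hab ha => ?_) hx
    rw [SimpleGraph.deleteEdges_adj] at hab
    exact hB a b hab.1 hab.2 ha
  -- One path through the unexplored vertices on each side of the cut replaces all edges between
  -- unexplored vertices.
  obtain ⟨H₁, a1, b1, c1⟩ := SimpleGraph.exists_path_on
    (Finset.univ.filter (fun z : Fin n => z ∉ Q ∧ z ∈ A))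
  obtain ⟨H₂, a2, b2, c2⟩ := SimpleGraph.exists_path_on
    (Finset.univ.filter (fun z : Fin n => z ∉ Q ∧ z ∉ A))
  simp only [Finset.mem_filter, Finset.mem_univ, true_and] at a1 c1 a2 c2
  let H : SimpleGraph (Fin n) :=
    { Adj := fun z w => ((z ∈ Q ∨ w ∈ Q) ∧ G.graph.Adj z w) ∨ H₁.Adj z w ∨ H₂.Adj z w
      symm := ⟨fun z w => by
        rintro (⟨k, k'⟩ | k | k)
        · exact Or.inl ⟨k.symm, k'.symm⟩
        · exact Or.inr (Or.inl k.symm)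
        · exact Or.inr (Or.inr k.symm)⟩
      loopless := ⟨fun z => by
        rintro (⟨k, k'⟩ | k | k)
        · exact k'.ne rfl
        · exact k.ne rfl
        · exact k.ne rfl⟩ }
  have hH : ∀ z w, H.Adj z w ↔
      ((z ∈ Q ∨ w ∈ Q) ∧ G.graph.Adj z w) ∨ H₁.Adj z w ∨ H₂.Adj z w := fun _ _ => Iff.rfl
  have hHQ : ∀ z ∈ Q, ∀ w, H.Adj z w ↔ G.graph.Adj z w := by
    intro z hz w
    rw [hH]
    constructor
    · rintro (⟨-, k⟩ | k | k)
      · exact k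
      · exact absurd hz (a1 z w k).1.1
      · exact absurd hz (a2 z w k).1.1
    · exact fun k => Or.inl ⟨Or.inl hz, k⟩
  have hcut : ∀ x y, H.Adj x y → s(x, y) ≠ s(u, v) → (x ∈ A ↔ y ∈ A) := by
    rintro x y (⟨k | k, k'⟩ | k | k) hne
    · exact hA x k y k' hne
    · exact (hA y k x k'.symm (by rwa [Sym2.eq_swap])).symm
    · exact iff_of_true (a1 x y k).1.2 (a1 x y k).2.2
    · exact iff_of_false (a2 x y k).1.2 (a2 x y k).2.2
  have hlist : ∀ z ∉ Q, ∃ l : Fin d → Option (Fin n), IsIncidenceList {w | H.Adj z w} l := by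
    intro z hz
    obtain ⟨p, hp⟩ : ∃ p, ∀ w ∈ Q, G.graph.Adj w z → w = p := by
      by_cases hex : ∃ p ∈ Q, G.graph.Adj p z
      · obtain ⟨p, hp, hpz⟩ := hex
        exact ⟨p, fun w hw hwz => h1 z hz w hw p hp hwz hpz⟩
      · exact ⟨z, fun w hw hwz => absurd ⟨w, hw, hwz⟩ hex⟩
    obtain ⟨q, r, hqr⟩ : ∃ q r, ∀ w, H₁.Adj z w ∨ H₂.Adj z w → w = q ∨ w = r := by
      by_cases hzA : z ∈ A
      · obtain ⟨q, r, hqr⟩ := b1 z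
        exact ⟨q, r, fun w hw => hw.elim (hqr w) (fun k => absurd hzA (a2 z w k).1.2)⟩
      · obtain ⟨q, r, hqr⟩ := b2 z
        exact ⟨q, r, fun w hw => hw.elim (fun k => absurd (a1 z w k).1.2 hzA) (hqr w)⟩
    -- One explored neighbour and two path neighbours: this is where `3 ≤ d` enters.
    have hsub : (Finset.univ.filter (fun w => H.Adj z w)) ⊆ {p, q, r} := by
      intro w hw
      rw [Finset.mem_filter, hH] at hw
      simp only [Finset.mem_insert, Finset.mem_singleton]
      rcases hw.2 with ⟨k | k, k'⟩ | k
      · exact absurd k hz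
      · exact Or.inl (hp w k k'.symm)
      · exact Or.inr (hqr w k)
    obtain ⟨l, hl⟩ := exists_isIncidenceList (d := d) (Finset.univ.filter (fun w => H.Adj z w))
      (((Finset.card_le_card hsub).trans Finset.card_le_three).trans hd)
    exact ⟨l, by simpa using hl⟩
  have hlistQ : ∀ z ∈ Q, IsIncidenceList {w | H.Adj z w} (G.nbr z) := by
    intro z hz
    have : {w | H.Adj z w} = {w | G.graph.Adj z w} := Set.ext fun w => hHQ z hz w
    rw [this]
    exact G.isIncidenceList z
  obtain ⟨G', hG'1, hG'2⟩ := exists_of_isIncidenceList_of_eq H Q G.nbr hlistQ hlist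
  refine ⟨G', ?_, hG'2, A, hA1, hA2, ?_⟩
  · rw [hG'1]
    have := hGc.nonempty
    by_contra hnc
    -- If the component `B` misses a vertex of one path, it misses that whole path. Then its part on
    -- that side of the cut is fully explored and closed in `G` without `u v`, although it contains
    -- only one of `u`, `v`, contradicting `hG`. If `B` contains both paths, its complement is
    -- explored, hence closed in `G`.
    have main : ∀ B : Set (Fin n), (∀ x y, H.Adj x y → (x ∈ B ↔ y ∈ B)) → u ∈ B →
        ∀ w, w ∈ B := by
      intro B hB huB
      have hvB : v ∈ B := (hB u v ((hHQ u hu v).2 huv)).1 huB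
      have hGB : ∀ x y, x ∈ Q → G.graph.Adj x y → x ∈ B → y ∈ B :=
        fun x y hx hxy => (hB x y ((hHQ x hx y).2 hxy)).1
      by_cases hP1 : ∀ z, z ∉ Q → z ∈ A → z ∈ B
      · by_cases hP2 : ∀ z, z ∉ Q → z ∉ A → z ∈ B
        · intro w
          by_contra hw
          refine (hGc.mem_of_closed (A := Bᶜ) (fun x y hxy hx hy => ?_) hw : u ∈ Bᶜ) huB
          have hxQ : x ∈ Q := by
            by_contra hxQ
            by_cases hxA : x ∈ A
            · exact hx (hP1 x hxQ hxA)
            · exact hx (hP2 x hxQ hxA)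
          exact hx ((hB x y ((hHQ x hxQ y).2 hxy)).2 hy)
        · exfalso
          push Not at hP2
          obtain ⟨p, hp1, hp2, hp3⟩ := hP2
          have hno : ∀ z, z ∉ Q → z ∉ A → z ∉ B := fun z hz hzA hzB =>
            hp3 (c2 B (fun x y k => (hB x y (Or.inr (Or.inr k))).1) z ⟨hz, hzA⟩ p ⟨hp1, hp2⟩ hzB)
          refine (hGe {z | z ∈ B ∧ z ∉ A} (fun x y hxy hne hx => ?_) v u ⟨hvB, hA2⟩).2 hA1
          have hxQ : x ∈ Q := by
            by_contra hxQ
            exact hno x hxQ hx.2 hx.1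
          exact ⟨hGB x y hxQ hxy hx.1, fun hy => hx.2 ((hA x hxQ y hxy hne).2 hy)⟩
      · exfalso
        push Not at hP1
        obtain ⟨p, hp1, hp2, hp3⟩ := hP1
        have hno : ∀ z, z ∉ Q → z ∈ A → z ∉ B := fun z hz hzA hzB =>
          hp3 (c1 B (fun x y k => (hB x y (Or.inr (Or.inl k))).1) z ⟨hz, hzA⟩ p ⟨hp1, hp2⟩ hzB)
        refine hA2 (hGe {z | z ∈ B ∧ z ∈ A} (fun x y hxy hne hx => ?_) u v ⟨huB, hA1⟩).2
        have hxQ : x ∈ Q := by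
          by_contra hxQ
          exact hno x hxQ hx.2 hx.1
        exact ⟨hGB x y hxQ hxy hx.1, (hA x hxQ y hxy hne).1 hx.2⟩
    obtain ⟨B, hB, ⟨p, hp⟩, r, hr⟩ := SimpleGraph.exists_closed_of_not_connected hnc
    by_cases huB : u ∈ B
    · exact hr (main B hB huB r)
    · exact main Bᶜ (fun x y hxy => not_congr (hB x y hxy)) huB p hp
  · rw [hG'1]
    exact fun x y hxy hne => (hcut x y hxy hne).1

end IncidenceGraph

/-! ### Undetected edges must be kept -/

namespace LocalAlgorithm

open IncidenceGraph

variable {Ω : Type*} [MeasurableSpace Ω] {n d : ℕ}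

theorem subgraph_adj (A : LocalAlgorithm Ω n d) (G : IncidenceGraph n d) (ω : Ω)
    (x y : Fin n) : (A.subgraph G ω).Adj x y ↔
      G.graph.Adj x y ∧ (A.proc ω s(x, y)).run G.nbr = true := by
  simp only [subgraph, SimpleGraph.fromEdgeSet_adj, Set.mem_ofPred_eq, SimpleGraph.mem_edgeSet]
  exact ⟨fun h => h.1, fun h => ⟨h, h.1.ne⟩⟩

/-- An edge has to be kept unless the queried lists show that it is not a bridge. -/
theorem run_eq_true_of_separated (hd : 3 ≤ d) {A : LocalAlgorithm Ω n d} {ω : Ω}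
    (hA : ∀ G ∈ connectedGraphs n d, (A.subgraph G ω).Connected)
    {G : IncidenceGraph n d} (hG : G ∈ connectedGraphs n d) {u v : Fin n}
    (huv : G.graph.Adj u v) {Q : Finset (Fin n)} (hu : u ∈ Q)
    (hvis : (A.proc ω s(u, v)).visited G.nbr ⊆ Q) (hsep : G.Separated u v Q) :
    (A.proc ω s(u, v)).run G.nbr = true := by
  by_contra hno
  -- A rejected edge is not a bridge of `G`, because the connected subgraph avoids it.
  have hle : A.subgraph G ω ≤ G.graph.deleteEdges {s(u, v)} := by
    intro x y hxy
    rw [subgraph_adj] at hxy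
    rw [SimpleGraph.deleteEdges_adj]
    refine ⟨hxy.1, fun he => hno ?_⟩
    rw [Set.mem_singleton_iff] at he
    exact he ▸ hxy.2
  obtain ⟨G', hG', hN, B, huB, hvB, hB⟩ := hsep.exists_bridge hd hu huv ((hA G hG).mono hle)
  refine hvB ((hA G' hG').mem_of_closed (fun x y hxy hx => ?_) huB)
  rw [subgraph_adj] at hxy
  refine hB x y hxy.1 (fun he => hno ?_) hx
  rw [← QueryTree.run_congr (N' := G'.nbr) _ (fun z hz => hN z (hvis hz)), ← he]
  exact hxy.2

end LocalAlgorithm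

/-! ### Counting dense graphs by switching -/

namespace IncidenceGraph

variable {n d : ℕ}

open Classical in
/-- The connected graphs with almost as many edges as a `d`-regular graph. -/
noncomputable def denseGraphs (n d : ℕ) : Finset (IncidenceGraph n d) :=
  {G | G.graph.Connected ∧ n * d ≤ G.darts.card + d * d}

theorem mem_denseGraphs {G : IncidenceGraph n d} :
    G ∈ denseGraphs n d ↔ G.graph.Connected ∧ n * d ≤ G.darts.card + d * d := by
  simp [denseGraphs]

open Classical in
/-- The dense connected graphs in which the vertices of `Q` have the lists given by `N`. -/
noncomputable def extensions (Q : Finset (Fin n)) (N : Fin n → Fin d → Option (Fin n)) :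
    Finset (IncidenceGraph n d) :=
  {G ∈ denseGraphs n d | ∀ z ∈ Q, G.nbr z = N z}

theorem mem_extensions {Q : Finset (Fin n)} {N : Fin n → Fin d → Option (Fin n)}
    {G : IncidenceGraph n d} :
    G ∈ extensions Q N ↔ G ∈ denseGraphs n d ∧ ∀ z ∈ Q, G.nbr z = N z := by
  simp [extensions]

/-- The lists of `G'` arise from those of `G` by replacing the edges `x y` and `p.1 p.2` by
`x p.1` and `y p.2`. -/
def IsSwitch (x y : Fin n) (G : IncidenceGraph n d) (p : Fin n × Fin n)
    (G' : IncidenceGraph n d) : Prop :=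
  ∀ v i, G'.nbr v i = (G.nbr v i).map (switchPerm x y p.1 p.2 v)

/-- With the positions `i`, `j` known, the new endpoints are read off as entry `i` of `x` and entry
`j` of `y` in `G'`. The permutations are then known and can be undone. -/
theorem IsSwitch.left_unique {x y : Fin n} {i j : Fin d} {G₁ G₂ G' : IncidenceGraph n d}
    {p₁ p₂ : Fin n × Fin n} (hxy : x ≠ y) (h₁ : IsSwitch x y G₁ p₁ G') (h₂ : IsSwitch x y G₂ p₂ G')
    (hi₁ : G₁.nbr x i = some y) (hj₁ : G₁.nbr y j = some x)
    (hi₂ : G₂.nbr x i = some y) (hj₂ : G₂.nbr y j = some x) : G₁ = G₂ ∧ p₁ = p₂ := by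
  have e1 := (h₁ x i).symm.trans (h₂ x i)
  have e2 := (h₁ y j).symm.trans (h₂ y j)
  rw [hi₁, hi₂] at e1
  rw [hj₁, hj₂] at e2
  simp only [Option.map_some, Option.some.injEq, switchPerm_apply, if_true, hxy.symm, if_false]
    at e1 e2
  have hp : p₁ = p₂ := Prod.ext e1 e2
  subst hp
  refine ⟨nbr_inj ?_, rfl⟩
  funext v k
  exact Option.map_injective (switchPerm x y p₁.1 p₁.2 v).injective
    ((h₁ v k).symm.trans (h₂ v k))

theorem exists_isSwitch_mem_extensions {Q : Finset (Fin n)}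
    {N : Fin n → Fin d → Option (Fin n)} {G : IncidenceGraph n d} (hG : G ∈ extensions Q N)
    {x y a b : Fin n} (hx : x ∉ Q) (hy : y ∉ Q) (ha : a ∉ Q) (hb : b ∉ Q)
    (h₁ : G.Switchable x y a b) (h₂ : G.Switchable x y b a) :
    (∃ G' ∈ extensions Q N, IsSwitch x y G (a, b) G') ∨
      ∃ G' ∈ extensions Q N, IsSwitch x y G (b, a) G' := by
  obtain ⟨hd, hN⟩ := mem_extensions.1 hG
  obtain ⟨hc, hm⟩ := mem_denseGraphs.1 hd
  have key : ∀ {a b : Fin n} {G' : IncidenceGraph n d}, a ∉ Q → b ∉ Q →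
      IsSwitch x y G (a, b) G' →
      (∀ v w, G'.graph.Adj v w ↔ G.graph.Adj v (switchPerm x y a b v w)) →
      G'.graph.Connected → G' ∈ extensions Q N := by
    intro a b G' ha hb hs hadj hconn
    refine mem_extensions.2 ⟨mem_denseGraphs.2 ⟨hconn, ?_⟩, fun z hz => ?_⟩
    · rw [card_darts_eq_of_adj_iff hadj]
      exact hm
    · rw [← hN z hz]
      funext k
      have hne : ∀ {t}, t ∉ Q → z ≠ t := fun ht h => ht (h ▸ hz)
      rw [hs z k]
      simp only [switchPerm, hne hx, hne hy, hne ha, hne hb, if_false]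
      simp
  obtain ⟨G₁, hs₁, ha₁⟩ := h₁.exists_switch
  obtain ⟨G₂, hs₂, ha₂⟩ := h₂.exists_switch
  obtain ⟨k1, k2, k3⟩ := h₁.adj_of_adj ha₁
  obtain ⟨l1, l2, l3⟩ := h₂.adj_of_adj ha₂
  rcases hc.switch k3 (fun v w hvw e1 e2 => l3 v w hvw e1 (by rwa [Sym2.eq_swap (a := b)]))
    k1 k2 l1 l2 with hconn | hconn
  · exact Or.inl ⟨G₁, key ha hb hs₁ ha₁ hconn, hs₁⟩
  · exact Or.inr ⟨G₂, key hb ha hs₂ ha₂ hconn, hs₂⟩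

-- An edge `a b` avoiding `Q`, `x`, `y` and the neighbours of `x` and `y` can be switched in both
-- ways, and one of them stays connected. So at least one orientation of it counts. At most `2 *
-- (Q.card + 2 + 2 * d) * d` darts are excluded.
open Classical in
theorem le_card_isSwitch {Q : Finset (Fin n)} {N : Fin n → Fin d → Option (Fin n)}
    {x y : Fin n} {M : ℕ} (hx : x ∉ Q) (hy : y ∉ Q)
    (hM : 2 * M + d * d + 2 * ((Q.card + 2 + 2 * d) * d) ≤ n * d)
    {G : IncidenceGraph n d} (hG : G ∈ extensions Q N) (hxy : G.graph.Adj x y) :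
    M ≤ (G.darts.filter fun p => ∃ G' ∈ extensions Q N, IsSwitch x y G p G').card := by
  have hm := (mem_denseGraphs.1 (mem_extensions.1 hG).1).2
  set W : Finset (Fin n) := Q ∪ {x, y} ∪ (G.neighbors x ∪ G.neighbors y) with hW
  have hWc : W.card ≤ Q.card + 2 + 2 * d := by
    refine (Finset.card_union_le _ _).trans (Nat.add_le_add
      ((Finset.card_union_le _ _).trans (Nat.add_le_add_left Finset.card_le_two _))
      ((Finset.card_union_le _ _).trans ?_))
    have := G.card_neighbors_le x
    have := G.card_neighbors_le y
    omega
  set P : Fin n × Fin n → Prop := fun p => ∃ G' ∈ extensions Q N, IsSwitch x y G p G'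
  have hcover : G.darts ⊆ ((G.darts.filter P ∪ G.darts.filter (fun p => P p.swap)) ∪
      (G.darts.filter (fun p => p.1 ∈ W) ∪ G.darts.filter (fun p => p.swap.1 ∈ W))) := by
    intro p hp
    obtain ⟨a, b⟩ := p
    simp only [Finset.mem_union, Finset.mem_filter, hp, true_and, Prod.fst_swap]
    by_cases ha : a ∈ W
    · exact Or.inr (Or.inl ha)
    by_cases hb : b ∈ W
    · exact Or.inr (Or.inr hb)
    refine Or.inl ?_
    simp only [hW, Finset.mem_union, Finset.mem_insert, Finset.mem_singleton, mem_neighbors,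
      not_or] at ha hb
    have hab : G.graph.Adj a b := mem_darts.1 hp
    obtain ⟨⟨ha1, ha2, ha3⟩, ha4, ha5⟩ := ha
    obtain ⟨⟨hb1, hb2, hb3⟩, hb4, hb5⟩ := hb
    exact exists_isSwitch_mem_extensions hG hx hy ha1 hb1
      ⟨hxy, hab, ha4, hb5, Ne.symm ha2, Ne.symm hb2, Ne.symm ha3, Ne.symm hb3⟩
      ⟨hxy, hab.symm, hb4, ha5, Ne.symm hb2, Ne.symm ha2, Ne.symm hb3, Ne.symm ha3⟩
  have h1 := (Finset.card_le_card hcover).trans ((Finset.card_union_le _ _).trans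
    (Nat.add_le_add (Finset.card_union_le _ _) (Finset.card_union_le _ _)))
  rw [G.card_filter_swap_darts P, G.card_filter_swap_darts (fun p => p.1 ∈ W)] at h1
  have h2 := G.card_darts_filter_fst_mem_le W
  have h3 := Nat.mul_le_mul_right d hWc
  change M ≤ (G.darts.filter P).card
  omega

open Classical in
/-- A prescribed edge outside `Q` is contained in only few of the dense graphs with prescribed
lists on `Q`. -/
theorem mul_card_filter_nbr_le {Q : Finset (Fin n)} {N : Fin n → Fin d → Option (Fin n)}
    {x y : Fin n} {M : ℕ} (i j : Fin d) (hx : x ∉ Q) (hy : y ∉ Q)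
    (hM : 2 * M + d * d + 2 * ((Q.card + 2 + 2 * d) * d) ≤ n * d) :
    ((extensions Q N).filter fun G => G.nbr x i = some y ∧ G.nbr y j = some x).card * M ≤
      (extensions Q N).card := by
  set F := (extensions Q N).filter fun G => G.nbr x i = some y ∧ G.nbr y j = some x with hF
  have hadj : ∀ G ∈ F, G.graph.Adj x y := fun G hG =>
    (G.adj_iff x y).2 ⟨i, (Finset.mem_filter.1 hG).2.1⟩
  -- Double counting of switches: at least `M` leave each graph of `F`, and each graph is reached by
  -- at most one.
  let S : Finset (Σ _ : IncidenceGraph n d, Fin n × Fin n) :=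
    F.sigma fun G => G.darts.filter fun p => ∃ G' ∈ extensions Q N, IsSwitch x y G p G'
  have hS : F.card * M ≤ S.card := by
    rw [Finset.card_sigma, ← smul_eq_mul]
    exact Finset.card_nsmul_le_sum _ _ _ fun G hG =>
      le_card_isSwitch hx hy hM (Finset.mem_filter.1 hG).1 (hadj G hG)
  refine hS.trans (Finset.card_le_card_of_forall_subsingleton
    (fun s G' => IsSwitch x y s.1 s.2 G') (fun s hs => ?_) ?_)
  · exact (Finset.mem_filter.1 (Finset.mem_sigma.1 hs).2).2
  · rintro G' - ⟨G₁, p₁⟩ ⟨hs₁, h₁⟩ ⟨G₂, p₂⟩ ⟨hs₂, h₂⟩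
    have m₁ := (Finset.mem_sigma.1 hs₁).1
    have m₂ := (Finset.mem_sigma.1 hs₂).1
    obtain ⟨rfl, rfl⟩ := h₁.left_unique (hadj _ m₁).ne h₂ (Finset.mem_filter.1 m₁).2.1
      (Finset.mem_filter.1 m₁).2.2 (Finset.mem_filter.1 m₂).2.1 (Finset.mem_filter.1 m₂).2.2
    rfl

open Classical in
/-- A fresh vertex rarely has a neighbour that is already known. -/
theorem card_filter_not_separated_insert_le {Q : Finset (Fin n)}
    {N : Fin n → Fin d → Option (Fin n)} {u v x : Fin n} {M : ℕ} (hu : u ∈ Q) (hx : x ∉ Q)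
    (hsep : ∀ G ∈ extensions Q N, G.graph.Adj u v ∧ G.Separated u v Q)
    (hM : 2 * M + d * d + 2 * ((Q.card + 2 + 2 * d) * d) ≤ n * d) :
    ((extensions Q N).filter fun G => ¬ G.Separated u v (insert x Q)).card * M ≤
      Q.card * d ^ 3 * (extensions Q N).card := by
  set Y : Finset (Fin n) :=
    Finset.univ.filter fun y => y ∉ Q ∧ ∃ p ∈ Q ×ˢ (Finset.univ : Finset (Fin d)),
      N p.1 p.2 = some y with hY
  have hYc : Y.card ≤ Q.card * d := by
    have := Finset.card_le_card_of_forall_subsingleton (s := Y)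
      (t := Q ×ˢ (Finset.univ : Finset (Fin d)))
      (fun y p => N p.1 p.2 = some y) (fun y hy => (Finset.mem_filter.1 hy).2.2)
      (by
        intro p _ y hy y' hy'
        exact Option.some.inj (hy.2.symm.trans hy'.2))
    simpa using this
  -- Union bound over the unexplored neighbours `y` of `Q`, at most `Q.card * d` of them, and the
  -- two positions at which the edge `x y` is listed.
  set I : Finset (Fin n × Fin d × Fin d) := Y ×ˢ Finset.univ with hI
  have hIc : I.card ≤ Q.card * d ^ 3 := by
    rw [hI, Finset.card_product]
    simp only [Finset.card_univ, Fintype.card_prod, Fintype.card_fin]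
    calc Y.card * (d * d) ≤ Q.card * d * (d * d) := Nat.mul_le_mul_right _ hYc
      _ = _ := by ring
  have hcover : ((extensions Q N).filter fun G => ¬ G.Separated u v (insert x Q)) ⊆
      I.biUnion fun t => (extensions Q N).filter fun G =>
        G.nbr x t.2.1 = some t.1 ∧ G.nbr t.1 t.2.2 = some x := by
    intro G hG
    obtain ⟨hG, hns⟩ := Finset.mem_filter.1 hG
    obtain ⟨huv, hs⟩ := hsep G hG
    have hex : ∃ y ∉ Q, G.graph.Adj x y ∧ ∃ z ∈ Q, G.graph.Adj z y := by
      by_contra! hc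
      exact hns (hs.insert huv hu hx fun y hy hxy z hz hzy => hc y hy hxy z hz hzy)
    obtain ⟨y, hy, hxy, z, hz, hzy⟩ := hex
    obtain ⟨i, hi⟩ := (G.adj_iff x y).1 hxy
    obtain ⟨j, hj⟩ := (G.adj_iff y x).1 hxy.symm
    obtain ⟨k, hk⟩ := (G.adj_iff z y).1 hzy
    rw [(mem_extensions.1 hG).2 z hz] at hk
    refine Finset.mem_biUnion.2 ⟨(y, i, j), ?_, Finset.mem_filter.2 ⟨hG, hi, hj⟩⟩
    refine Finset.mem_product.2 ⟨Finset.mem_filter.2 ⟨Finset.mem_univ _, hy, (z, k), ?_, hk⟩,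
      Finset.mem_univ _⟩
    exact Finset.mem_product.2 ⟨hz, Finset.mem_univ _⟩
  calc _ ≤ (∑ t ∈ I, ((extensions Q N).filter fun G =>
        G.nbr x t.2.1 = some t.1 ∧ G.nbr t.1 t.2.2 = some x).card) * M :=
        Nat.mul_le_mul_right _ ((Finset.card_le_card hcover).trans Finset.card_biUnion_le)
    _ = ∑ t ∈ I, ((extensions Q N).filter fun G =>
        G.nbr x t.2.1 = some t.1 ∧ G.nbr t.1 t.2.2 = some x).card * M := Finset.sum_mul _ _ _
    _ ≤ I.card * (extensions Q N).card := by
        rw [← smul_eq_mul (a := I.card)]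
        refine Finset.sum_le_card_nsmul _ _ _ fun t ht => ?_
        exact mul_card_filter_nbr_le _ _ hx
          (Finset.mem_filter.1 (Finset.mem_product.1 ht).1).2.1 hM
    _ ≤ _ := Nat.mul_le_mul_right _ hIc

open Classical in
/-- A query procedure with few queries rarely finds out that `u v` is not a bridge. -/
theorem card_filter_not_separated_visited_le {u v : Fin n} {q M : ℕ}
    (hM : 2 * M + d * d + 2 * ((q + 2 + 2 * d) * d) ≤ n * d) (T : QueryTree n d) :
    ∀ (k : ℕ) (Q : Finset (Fin n)) (N : Fin n → Fin d → Option (Fin n)), u ∈ Q →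
      Q.card + k ≤ q + 1 →
      (∀ G ∈ extensions Q N, T.cost G.nbr ≤ k ∧ G.graph.Adj u v ∧ G.Separated u v Q) →
      ((extensions Q N).filter fun G => ¬ G.Separated u v (Q ∪ T.visited G.nbr)).card * M ≤
        k * (q * d ^ 3) * (extensions Q N).card := by
  induction T with
  | answer b =>
    intro k Q N hu hk h
    have : ((extensions Q N).filter fun G =>
        ¬ G.Separated u v (Q ∪ (QueryTree.answer b).visited G.nbr)) = ∅ := by
      refine Finset.filter_eq_empty_iff.2 fun G hG => ?_
      simpa [QueryTree.visited] using (h G hG).2.2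
    simp [this]
  | query x i next ih =>
    intro k Q N hu hk h
    rcases (extensions Q N).eq_empty_or_nonempty with he | ⟨G₀, hG₀⟩
    · simp [he]
    obtain ⟨k, rfl⟩ : ∃ k', k = k' + 1 := by
      have := (h G₀ hG₀).1
      simp only [QueryTree.cost] at this
      exact ⟨k - 1, by omega⟩
    by_cases hx : x ∈ Q
    · have hN : ∀ G ∈ extensions Q N, G.nbr x i = N x i := fun G hG => by
        rw [(mem_extensions.1 hG).2 x hx]
      have := ih (N x i) k Q N hu (by omega) (fun G hG => by
        have h' := h G hG
        simp only [QueryTree.cost, hN G hG] at h'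
        exact ⟨by omega, h'.2⟩)
      have heq : ((extensions Q N).filter fun G =>
          ¬ G.Separated u v (Q ∪ (QueryTree.query x i next).visited G.nbr)) =
          (extensions Q N).filter fun G => ¬ G.Separated u v (Q ∪ (next (N x i)).visited G.nbr) := by
        refine Finset.filter_congr fun G hG => ?_
        simp only [QueryTree.visited, hN G hG, Finset.union_insert]
        rw [Finset.insert_eq_of_mem (Finset.mem_union_left _ hx)]
      rw [heq]
      refine this.trans (Nat.mul_le_mul_right _ (Nat.mul_le_mul_right _ (Nat.le_succ k)))
    -- A failure is either caused by the fresh vertex `x` itself or arises later. The later ones are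
    -- counted by induction after conditioning on the whole list of `x`.
    · set E := extensions Q N with hE
      set bad : IncidenceGraph n d → Prop := fun G =>
        ¬ G.Separated u v (Q ∪ (QueryTree.query x i next).visited G.nbr) with hbad
      set early : IncidenceGraph n d → Prop := fun G => ¬ G.Separated u v (insert x Q) with hearly
      have hstep := card_filter_not_separated_insert_le (M := M) hu hx (fun G hG => (h G hG).2)
        (le_trans (by
          have := Nat.mul_le_mul_right d (show Q.card + 2 + 2 * d ≤ q + 2 + 2 * d by omega)
          omega) hM)
      have hfib : ∀ l : Fin d → Option (Fin n),
          E.filter (fun G => G.nbr x = l) = extensions (insert x Q) (Function.update N x l) := by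
        intro l
        ext G
        simp only [hE, Finset.mem_filter, mem_extensions, Finset.mem_insert, forall_eq_or_imp,
          Function.update_self]
        have : (∀ z ∈ Q, G.nbr z = Function.update N x l z) ↔ ∀ z ∈ Q, G.nbr z = N z := by
          refine forall₂_congr fun z hz => ?_
          rw [Function.update_of_ne (by rintro rfl; exact hx hz)]
        rw [this]
        tauto
      have hlate : ∀ l : Fin d → Option (Fin n),
          ((E.filter fun G => bad G ∧ ¬ early G).filter fun G => G.nbr x = l).card * M ≤
            k * (q * d ^ 3) * (E.filter fun G => G.nbr x = l).card := by
        intro l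
        -- Separation depends only on the lists of the explored vertices, so it holds for all graphs
        -- of the fibre or for none.
        by_cases hs : ∃ G₁ ∈ E.filter fun G => G.nbr x = l, G₁.Separated u v (insert x Q)
        · obtain ⟨G₁, hG₁, hs₁⟩ := hs
          rw [hfib] at hG₁
          have hmem : ∀ G ∈ extensions (insert x Q) (Function.update N x l),
              G ∈ E ∧ G.nbr x = l := fun G hG => by
            rwa [← hfib, Finset.mem_filter] at hG
          have := ih (l i) k (insert x Q) (Function.update N x l) (Finset.mem_insert_of_mem hu)
            (by rw [Finset.card_insert_of_notMem hx]; omega) (fun G hG => by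
              obtain ⟨hGE, hGl⟩ := hmem G hG
              have h' := h G hGE
              simp only [QueryTree.cost, hGl] at h'
              refine ⟨by omega, h'.2.1, hs₁.congr fun z hz => ?_⟩
              rw [(mem_extensions.1 hG).2 z hz, (mem_extensions.1 hG₁).2 z hz])
          rw [hfib]
          refine le_trans (Nat.mul_le_mul_right _ (Finset.card_le_card fun G hG => ?_)) this
          simp only [Finset.mem_filter] at hG ⊢
          obtain ⟨⟨hGE, hb, -⟩, hGl⟩ := hG
          refine ⟨by rw [← hfib, Finset.mem_filter]; exact ⟨hGE, hGl⟩, ?_⟩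
          simpa only [hbad, QueryTree.visited, hGl, Finset.union_insert, Finset.insert_union]
            using hb
        · have : ((E.filter fun G => bad G ∧ ¬ early G).filter fun G => G.nbr x = l) = ∅ := by
            refine Finset.filter_eq_empty_iff.2 fun G hG hGl => hs ?_
            obtain ⟨hGE, -, hne⟩ := Finset.mem_filter.1 hG
            exact ⟨G, Finset.mem_filter.2 ⟨hGE, hGl⟩, not_not.1 hne⟩
          simp [this]
      have hsum : (E.filter fun G => bad G ∧ ¬ early G).card * M ≤ k * (q * d ^ 3) * E.card := by
        rw [Finset.card_eq_sum_card_fiberwise (s := E.filter fun G => bad G ∧ ¬ early G)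
          (f := fun G => G.nbr x) (t := Finset.univ) (by intro _ _; simp),
          Finset.card_eq_sum_card_fiberwise (s := E) (f := fun G => G.nbr x) (t := Finset.univ)
            (by intro _ _; simp), Finset.sum_mul, Finset.mul_sum]
        exact Finset.sum_le_sum fun l _ => hlate l
      have hsplit : (E.filter bad).card ≤
          (E.filter early).card + (E.filter fun G => bad G ∧ ¬ early G).card := by
        refine le_trans (Finset.card_le_card fun G hG => ?_) (Finset.card_union_le _ _)
        simp only [Finset.mem_union, Finset.mem_filter] at hG ⊢
        tauto
      have hQ : Q.card * d ^ 3 * E.card ≤ q * d ^ 3 * E.card :=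
        Nat.mul_le_mul_right _ (Nat.mul_le_mul_right _ (by omega))
      calc (E.filter bad).card * M
          ≤ ((E.filter early).card + (E.filter fun G => bad G ∧ ¬ early G).card) * M :=
            Nat.mul_le_mul_right _ hsplit
        _ = (E.filter early).card * M + (E.filter fun G => bad G ∧ ¬ early G).card * M :=
            Nat.add_mul _ _ _
        _ ≤ q * d ^ 3 * E.card + k * (q * d ^ 3) * E.card :=
            Nat.add_le_add (hstep.trans hQ) hsum
        _ = (k + 1) * (q * d ^ 3) * E.card := by ring

end IncidenceGraph

/-! ### Existence of dense connected graphs -/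

namespace IncidenceGraph

variable {n d : ℕ}

theorem exists_connected (hn : 0 < n) (hd : 2 ≤ d) :
    ∃ G : IncidenceGraph n d, G.graph.Connected := by
  classical
  obtain ⟨H, -, h2, h3⟩ := SimpleGraph.exists_path_on (Finset.univ : Finset (Fin n))
  have : Nonempty (Fin n) := ⟨⟨0, hn⟩⟩
  have hc : H.Connected := SimpleGraph.connected_of_closed fun A hA v w =>
    h3 A hA v (Finset.mem_univ v) w (Finset.mem_univ w)
  obtain ⟨G, hG⟩ := exists_of_isIncidenceList (d := d) H fun v => by
    obtain ⟨a, b, hab⟩ := h2 v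
    have hsub : (Finset.univ.filter fun w => H.Adj v w) ⊆ {a, b} := fun w hw => by
      simpa using hab w (Finset.mem_filter.1 hw).2
    obtain ⟨l, hl⟩ := exists_isIncidenceList (d := d) (Finset.univ.filter fun w => H.Adj v w)
      (((Finset.card_le_card hsub).trans Finset.card_le_two).trans hd)
    exact ⟨l, by simpa using hl⟩
  exact ⟨G, hG ▸ hc⟩

theorem sum_card_neighbors_le (G : IncidenceGraph n d) :
    ∑ v, (G.neighbors v).card ≤ G.darts.card := by
  rw [← Finset.card_sigma]
  refine Finset.card_le_card_of_injOn (fun p => (p.1, p.2)) (fun p hp => ?_) ?_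
  · simpa using hp
  · rintro ⟨a, b⟩ - ⟨a', b'⟩ - h
    obtain ⟨rfl, rfl⟩ := Prod.mk.inj h
    rfl

/-- An edge between two vertices with fewer than `d` neighbours can be added. -/
theorem exists_card_darts_lt {G : IncidenceGraph n d} (hG : G.graph.Connected) {u v : Fin n}
    (huv : u ≠ v) (hadj : ¬ G.graph.Adj u v) (hu : (G.neighbors u).card < d)
    (hv : (G.neighbors v).card < d) :
    ∃ G' : IncidenceGraph n d, G'.graph.Connected ∧ G.darts.card < G'.darts.card := by
  classical
  have hH : ∀ x y, (G.graph ⊔ SimpleGraph.edge u v).Adj x y ↔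
      G.graph.Adj x y ∨ (x = u ∧ y = v ∨ x = v ∧ y = u) := by
    intro x y
    rw [SimpleGraph.sup_adj, SimpleGraph.edge_adj]
    constructor
    · tauto
    · rintro (h | ⟨rfl, rfl⟩ | ⟨rfl, rfl⟩)
      · exact Or.inl h
      · exact Or.inr ⟨Or.inl ⟨rfl, rfl⟩, huv⟩
      · exact Or.inr ⟨Or.inr ⟨rfl, rfl⟩, huv.symm⟩
  obtain ⟨G', hG'⟩ := exists_of_isIncidenceList (d := d) (G.graph ⊔ SimpleGraph.edge u v)
    fun x => by
      have hcard : (Finset.univ.filter fun y => (G.graph ⊔ SimpleGraph.edge u v).Adj x y).card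
          ≤ d := by
        by_cases hxu : x = u
        · subst hxu
          refine (Finset.card_le_card (t := insert v (G.neighbors x)) fun y hy => ?_).trans
            ((Finset.card_insert_le _ _).trans hu)
          have := (hH x y).1 (Finset.mem_filter.1 hy).2
          rw [Finset.mem_insert, mem_neighbors]
          tauto
        by_cases hxv : x = v
        · subst hxv
          refine (Finset.card_le_card (t := insert u (G.neighbors x)) fun y hy => ?_).trans
            ((Finset.card_insert_le _ _).trans hv)
          have := (hH x y).1 (Finset.mem_filter.1 hy).2
          rw [Finset.mem_insert, mem_neighbors]
          tauto
        · refine (Finset.card_le_card fun y hy => ?_).trans (G.card_neighbors_le x)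
          have := (hH x y).1 (Finset.mem_filter.1 hy).2
          rw [mem_neighbors]
          tauto
      obtain ⟨l, hl⟩ := exists_isIncidenceList (d := d) _ hcard
      exact ⟨l, by simpa using hl⟩
  refine ⟨G', hG' ▸ hG.mono le_sup_left, Finset.card_lt_card ?_⟩
  rw [Finset.ssubset_iff_of_subset]
  · refine ⟨(u, v), ?_, by simpa using hadj⟩
    rw [mem_darts, hG', hH]
    exact Or.inr (Or.inl ⟨rfl, rfl⟩)
  · intro p hp
    rw [mem_darts, hG', hH]
    exact Or.inl (mem_darts.1 hp)

/-- In a connected graph with the most edges, vertices of degree below `d` are pairwise adjacent.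
Hence there are at most `d` of them, which costs at most `d * d` darts. The slack avoids
constructing regular graphs, which do not exist when `n * d` is odd. -/
theorem denseGraphs_nonempty (hn : 0 < n) (hd : 2 ≤ d) : (denseGraphs n d).Nonempty := by
  classical
  obtain ⟨G₀, hG₀⟩ := exists_connected hn hd
  obtain ⟨G, hG, hmax⟩ := Finset.exists_max_image
    (Finset.univ.filter fun G : IncidenceGraph n d => G.graph.Connected) (fun G => G.darts.card)
    ⟨G₀, by simpa using hG₀⟩
  simp only [Finset.mem_filter, Finset.mem_univ, true_and] at hG hmax
  refine ⟨G, mem_denseGraphs.2 ⟨hG, ?_⟩⟩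
  set D := Finset.univ.filter fun v => (G.neighbors v).card < d with hD
  have hDc : D.card ≤ d := by
    rcases D.eq_empty_or_nonempty with h | ⟨v, hv⟩
    · simp [h]
    · have hv' := (Finset.mem_filter.1 hv).2
      refine (Finset.card_le_card (t := insert v (G.neighbors v)) fun w hw => ?_).trans
        ((Finset.card_insert_le _ _).trans hv')
      rw [Finset.mem_insert, mem_neighbors]
      by_contra! hc
      obtain ⟨G', h1, h2⟩ := exists_card_darts_lt hG (Ne.symm hc.1) hc.2 hv'
        (Finset.mem_filter.1 hw).2
      exact absurd (hmax G' h1) (not_le.2 h2)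
  have h1 : ∑ _v : Fin n, d ≤ ∑ v : Fin n, ((G.neighbors v).card + if v ∈ D then d else 0) := by
    refine Finset.sum_le_sum fun v _ => ?_
    by_cases hv : v ∈ D
    · simp [hv]
    · have : ¬ (G.neighbors v).card < d := by simpa [hD] using hv
      omega
  rw [Finset.sum_add_distrib, Finset.sum_ite_mem] at h1
  simp only [Finset.sum_const, Finset.card_univ, Fintype.card_fin, smul_eq_mul,
    Finset.univ_inter] at h1
  have h2 := G.sum_card_neighbors_le
  have h3 := Nat.mul_le_mul_right d hDc
  omega

end IncidenceGraph

/-! ### Averaging over graphs, edges and coins -/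

namespace LocalAlgorithm

open IncidenceGraph

variable {Ω : Type*} [MeasurableSpace Ω] {n d : ℕ}

open Classical in
/-- For a fixed outcome of the coins, only few edges of the dense graphs are answered negatively
if few queries are made. -/
theorem sum_card_filter_run_ne_true_le (hd : 3 ≤ d) {A : LocalAlgorithm Ω n d} {ω : Ω}
    {q M : ℕ} (hA : ∀ G ∈ connectedGraphs n d, (A.subgraph G ω).Connected)
    (hq : ∀ G ∈ connectedGraphs n d, ∀ e ∈ G.graph.edgeSet, (A.proc ω e).cost G.nbr ≤ q)
    (hM : 2 * M + d * d + 2 * ((q + 2 + 2 * d) * d) ≤ n * d) :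
    (∑ G ∈ denseGraphs n d,
      (G.darts.filter fun p => ¬ (A.proc ω s(p.1, p.2)).run G.nbr = true).card) * M ≤
      q * (q * d ^ 3) * ∑ G ∈ denseGraphs n d, G.darts.card := by
  set no : Fin n × Fin n → IncidenceGraph n d → Prop :=
    fun p G => ¬ (A.proc ω s(p.1, p.2)).run G.nbr = true with hno
  have hconn : ∀ G ∈ denseGraphs n d, G ∈ connectedGraphs n d := fun G hG =>
    (mem_denseGraphs.1 hG).1
  -- The exploration starts with the list of `p.1` already revealed: then the presence of the edge
  -- is determined, and the starting set `{p.1}` is separated.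
  have hlist : ∀ (p : Fin n × Fin n) (l : Fin d → Option (Fin n)),
      ((denseGraphs n d).filter fun G => (G.graph.Adj p.1 p.2 ∧ no p G) ∧ G.nbr p.1 = l).card * M ≤
        q * (q * d ^ 3) *
          ((denseGraphs n d).filter fun G => G.graph.Adj p.1 p.2 ∧ G.nbr p.1 = l).card := by
    rintro ⟨u, v⟩ l
    by_cases hv : ∃ i, l i = some v
    · have hadj : ∀ G : IncidenceGraph n d, G.nbr u = l → G.graph.Adj u v := fun G hG =>
        (G.adj_iff u v).2 (hG ▸ hv)
      have hext : ((denseGraphs n d).filter fun G => G.graph.Adj u v ∧ G.nbr u = l) =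
          extensions {u} (fun _ => l) := by
        ext G
        simp only [Finset.mem_filter, mem_extensions, Finset.mem_singleton, forall_eq]
        exact and_congr_right fun _ => ⟨fun h => h.2, fun h => ⟨hadj G h, h⟩⟩
      have hmem : ∀ G ∈ extensions {u} (fun _ => l), G ∈ denseGraphs n d ∧ G.graph.Adj u v :=
        fun G hG => by
          rw [← hext, Finset.mem_filter] at hG
          exact ⟨hG.1, hG.2.1⟩
      have := card_filter_not_separated_visited_le (u := u) (v := v) hM (A.proc ω s(u, v)) q {u}
        (fun _ => l) (Finset.mem_singleton_self u) (by simp [add_comm]) (fun G hG => by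
          obtain ⟨h1, h2⟩ := hmem G hG
          exact ⟨hq G (hconn G h1) _ h2, h2, G.separated_singleton h2.ne⟩)
      simp only
      rw [hext]
      refine le_trans (Nat.mul_le_mul_right _ (Finset.card_le_card fun G hG => ?_)) this
      obtain ⟨hGd, ⟨hGuv, hGno⟩, hGl⟩ := Finset.mem_filter.1 hG
      refine Finset.mem_filter.2 ⟨?_, fun hs => hGno ?_⟩
      · rw [← hext]
        exact Finset.mem_filter.2 ⟨hGd, hGuv, hGl⟩
      · exact run_eq_true_of_separated hd hA (hconn G hGd) hGuv
          (Finset.mem_union_left _ (Finset.mem_singleton_self u)) Finset.subset_union_right hs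
    · have : ((denseGraphs n d).filter fun G => (G.graph.Adj u v ∧ no (u, v) G) ∧ G.nbr u = l) =
          ∅ := by
        refine Finset.filter_eq_empty_iff.2 fun G _ hG => hv ?_
        rw [← hG.2]
        exact (G.adj_iff u v).1 hG.1.1
      simp [this]
  have hedge : ∀ p : Fin n × Fin n,
      ((denseGraphs n d).filter fun G => G.graph.Adj p.1 p.2 ∧ no p G).card * M ≤
        q * (q * d ^ 3) * ((denseGraphs n d).filter fun G => G.graph.Adj p.1 p.2).card := by
    intro p
    rw [Finset.card_eq_sum_card_fiberwise (f := fun G => G.nbr p.1) (t := Finset.univ)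
      (s := (denseGraphs n d).filter fun G => G.graph.Adj p.1 p.2 ∧ no p G)
      (by intro _ _; simp),
      Finset.card_eq_sum_card_fiberwise (f := fun G => G.nbr p.1) (t := Finset.univ)
      (s := (denseGraphs n d).filter fun G => G.graph.Adj p.1 p.2)
      (by intro _ _; simp), Finset.sum_mul, Finset.mul_sum]
    refine Finset.sum_le_sum fun l _ => ?_
    rw [Finset.filter_filter, Finset.filter_filter]
    exact hlist p l
  have h1 := Finset.sum_card_bipartiteAbove_eq_sum_card_bipartiteBelow
    (s := denseGraphs n d) (t := (Finset.univ : Finset (Fin n × Fin n)))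
    (fun G p => G.graph.Adj p.1 p.2 ∧ no p G)
  have h2 := Finset.sum_card_bipartiteAbove_eq_sum_card_bipartiteBelow
    (s := denseGraphs n d) (t := (Finset.univ : Finset (Fin n × Fin n)))
    (fun G p => G.graph.Adj p.1 p.2)
  simp only [Finset.bipartiteAbove, Finset.bipartiteBelow] at h1 h2
  have h3 : ∀ G : IncidenceGraph n d, (G.darts.filter fun p => no p G) =
      Finset.univ.filter fun p : Fin n × Fin n => G.graph.Adj p.1 p.2 ∧ no p G := by
    intro G
    ext p
    simp
  have h4 : ∀ G : IncidenceGraph n d, G.darts =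
      Finset.univ.filter fun p : Fin n × Fin n => G.graph.Adj p.1 p.2 := by
    intro G
    ext p
    simp
  calc _ = (∑ p : Fin n × Fin n,
        ((denseGraphs n d).filter fun G => G.graph.Adj p.1 p.2 ∧ no p G).card) * M := by
        rw [← h1]
        refine congrArg (· * M) (Finset.sum_congr rfl fun G _ => ?_)
        rw [← h3]
    _ = ∑ p : Fin n × Fin n,
        ((denseGraphs n d).filter fun G => G.graph.Adj p.1 p.2 ∧ no p G).card * M :=
        Finset.sum_mul _ _ _
    _ ≤ ∑ p : Fin n × Fin n, q * (q * d ^ 3) *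
        ((denseGraphs n d).filter fun G => G.graph.Adj p.1 p.2).card :=
        Finset.sum_le_sum fun p _ => hedge p
    _ = q * (q * d ^ 3) * ∑ p : Fin n × Fin n,
        ((denseGraphs n d).filter fun G => G.graph.Adj p.1 p.2).card := (Finset.mul_sum _ _ _).symm
    _ = _ := by
        rw [← h2]
        refine congrArg _ (Finset.sum_congr rfl fun G _ => ?_)
        rw [← h4]

open Classical in
theorem card_darts_le_add_ncard_edgeSet (A : LocalAlgorithm Ω n d) (G : IncidenceGraph n d)
    (ω : Ω) : G.darts.card ≤
      (G.darts.filter fun p => ¬ (A.proc ω s(p.1, p.2)).run G.nbr = true).card +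
        2 * (A.subgraph G ω).edgeSet.ncard := by
  rw [← Finset.card_filter_add_card_filter_not (s := G.darts)
    (fun p => (A.proc ω s(p.1, p.2)).run G.nbr = true), add_comm]
  refine Nat.add_le_add_left (le_of_eq ?_) _
  rw [← SimpleGraph.coe_edgeFinset, Set.ncard_coe_finset, SimpleGraph.two_mul_card_edgeFinset]
  congr 1
  ext p
  simp [subgraph_adj]

/-- The edge count factors through the vector of answers, which takes values in a finite discrete
space. -/
theorem measurableSet_ncard_edgeSet_le (A : LocalAlgorithm Ω n d) (G : IncidenceGraph n d)
    (r : ℝ) : MeasurableSet {ω | ((A.subgraph G ω).edgeSet.ncard : ℝ) ≤ r} := by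
  let f : Ω → Sym2 (Fin n) → Bool := fun ω e => (A.proc ω e).run G.nbr
  have hf : Measurable f := measurable_pi_iff.2 fun e =>
    measurable_to_bool (A.measurableSet_yes e G)
  exact hf (t := {g | ((SimpleGraph.fromEdgeSet
    {e | e ∈ G.graph.edgeSet ∧ g e = true}).edgeSet.ncard : ℝ) ≤ r})
    (Set.toFinite _).measurableSet

end LocalAlgorithm

/-- If each of finitely many events has probability at least `c`, then with positive probability
at least a `c`-fraction of them occurs. -/
theorem exists_mul_card_le_card_filter {Ω ι : Type*} [MeasurableSpace Ω]
    {μ : MeasureTheory.Measure Ω} [MeasureTheory.IsProbabilityMeasure μ] {s : Finset ι}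
    {S : ι → Set Ω} {c : ℝ} {P : Ω → Prop} (hS : ∀ i ∈ s, MeasurableSet (S i))
    (hc : ∀ i ∈ s, c ≤ μ.real (S i)) (hP : ∀ᵐ ω ∂μ, P ω) :
    ∃ ω, P ω ∧ ∃ t ⊆ s, (∀ i ∈ t, ω ∈ S i) ∧ c * s.card ≤ t.card := by
  classical
  have hint : ∀ i ∈ s, MeasureTheory.Integrable ((S i).indicator (1 : Ω → ℝ)) μ := fun i hi =>
    (MeasureTheory.integrable_const (1 : ℝ)).indicator (hS i hi)
  -- First moment method: outside the null set where `P` fails, some outcome has at least the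
  -- expected number of events.
  obtain ⟨ω, hω, hle⟩ := MeasureTheory.exists_notMem_null_integral_le
    (MeasureTheory.integrable_finsetSum s hint) (MeasureTheory.ae_iff.1 hP)
  refine ⟨ω, by simpa using hω, s.filter (fun i => ω ∈ S i), Finset.filter_subset _ _,
    fun i hi => (Finset.mem_filter.1 hi).2, ?_⟩
  rw [MeasureTheory.integral_finsetSum s hint] at hle
  calc c * s.card = ∑ i ∈ s, c := by rw [Finset.sum_const, nsmul_eq_mul, mul_comm]
    _ ≤ ∑ i ∈ s, ∫ a, (S i).indicator (1 : Ω → ℝ) a ∂μ := by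
        refine Finset.sum_le_sum fun i hi => ?_
        rw [MeasureTheory.integral_indicator_one (hS i hi)]
        exact hc i hi
    _ ≤ ∑ i ∈ s, (S i).indicator (1 : Ω → ℝ) ω := hle
    _ = _ := by
        rw [Finset.card_filter, Nat.cast_sum]
        refine Finset.sum_congr rfl fun i _ => ?_
        by_cases h : ω ∈ S i <;> simp [h]

namespace LocalAlgorithm

open IncidenceGraph

/-- The quantitative form of the lower bound. -/
theorem le_sq_mul_of_isLocalSparseSpanning {Ω : Type*} [MeasurableSpace Ω]
    {μ : MeasureTheory.Measure Ω} [MeasureTheory.IsProbabilityMeasure μ] {n d q M : ℕ} {ε δ : ℝ}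
    (hn : 0 < n) (hd : 3 ≤ d) (hδ : δ ≤ 1 / 3)
    (hM : 2 * M + d * d + 2 * ((q + 2 + 2 * d) * d) ≤ n * d)
    {A : LocalAlgorithm Ω n d} (hA : A.IsLocalSparseSpanning μ (connectedGraphs n d) ε δ)
    (hq : A.QueryComplexityAtMost μ (connectedGraphs n d) q)
    (hL : 0 ≤ (n : ℝ) * d - d * d - 2 * ((1 + ε) * n)) :
    2 / 3 * ((n : ℝ) * d - d * d - 2 * ((1 + ε) * n)) * M ≤ q * (q * d ^ 3) * (n * d) := by
  classical
  set L : ℝ := (n : ℝ) * d - d * d - 2 * ((1 + ε) * n) with hLdef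
  have hconn : ∀ G ∈ denseGraphs n d, G ∈ connectedGraphs n d := fun G hG =>
    (mem_denseGraphs.1 hG).1
  have hgood : ∀ᵐ ω ∂μ, ∀ G : IncidenceGraph n d, G ∈ connectedGraphs n d →
      (A.subgraph G ω).Connected ∧
        ∀ e : Sym2 (Fin n), e ∈ G.graph.edgeSet → (A.proc ω e).cost G.nbr ≤ q := by
    refine MeasureTheory.ae_all_iff.2 fun G => ?_
    by_cases hG : G ∈ connectedGraphs n d
    · have h1 : ∀ᵐ ω ∂μ, ∀ e : Sym2 (Fin n), e ∈ G.graph.edgeSet →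
          (A.proc ω e).cost G.nbr ≤ q := by
        refine MeasureTheory.ae_all_iff.2 fun e => ?_
        by_cases he : e ∈ G.graph.edgeSet
        · exact (hq G hG e he).mono fun _ h _ => h
        · exact Filter.Eventually.of_forall fun _ h => absurd h he
      filter_upwards [(hA G hG).1, h1] with ω h2 h3 _
      exact ⟨h2, h3⟩
    · exact Filter.Eventually.of_forall fun _ h => absurd h hG
  obtain ⟨ω, hω, t, hts, ht, hcard⟩ := exists_mul_card_le_card_filter (s := denseGraphs n d)
    (c := 2 / 3) (fun G _ => A.measurableSet_ncard_edgeSet_le G ((1 + ε) * n))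
    (fun G hG => le_trans (by linarith) (hA G (hconn G hG)).2) hgood
  have hsum := sum_card_filter_run_ne_true_le hd (fun G hG => (hω G hG).1)
    (fun G hG => (hω G hG).2) hM
  set no : IncidenceGraph n d → ℕ := fun G =>
    (G.darts.filter fun p => ¬ (A.proc ω s(p.1, p.2)).run G.nbr = true).card with hno
  -- `L` counts darts, so each kept edge is subtracted twice and `d * d` is the density slack.
  have hlow : ∀ G ∈ t, L ≤ no G := by
    intro G hG
    have h1 : (G.darts.card : ℝ) ≤ no G + 2 * (A.subgraph G ω).edgeSet.ncard := by
      exact_mod_cast A.card_darts_le_add_ncard_edgeSet G ω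
    have h2 : (n : ℝ) * d ≤ G.darts.card + d * d := by
      exact_mod_cast (mem_denseGraphs.1 (hts hG)).2
    have h3 : ((A.subgraph G ω).edgeSet.ncard : ℝ) ≤ (1 + ε) * n := ht G hG
    linarith
  have hnosum : 2 / 3 * (denseGraphs n d).card * L ≤ ((∑ G ∈ denseGraphs n d, no G : ℕ) : ℝ) := by
    calc 2 / 3 * ((denseGraphs n d).card : ℝ) * L ≤ t.card * L :=
          mul_le_mul_of_nonneg_right hcard hL
      _ = ∑ _G ∈ t, L := by rw [Finset.sum_const, nsmul_eq_mul]
      _ ≤ ∑ G ∈ t, (no G : ℝ) := Finset.sum_le_sum hlow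
      _ ≤ ∑ G ∈ denseGraphs n d, (no G : ℝ) :=
          Finset.sum_le_sum_of_subset_of_nonneg hts fun _ _ _ => Nat.cast_nonneg _
      _ = _ := (Nat.cast_sum _ _).symm
  have hup : (∑ G ∈ denseGraphs n d, no G) * M ≤
      q * (q * d ^ 3) * ((denseGraphs n d).card * (n * d)) :=
    hsum.trans (Nat.mul_le_mul_left _ (by
      rw [← smul_eq_mul (a := (denseGraphs n d).card)]
      exact Finset.sum_le_card_nsmul _ _ _ fun G _ => G.card_darts_le))
  have hup' : ((∑ G ∈ denseGraphs n d, no G : ℕ) : ℝ) * M ≤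
      q * (q * d ^ 3) * ((denseGraphs n d).card * (n * d)) := by exact_mod_cast hup
  have hpos : (0 : ℝ) < (denseGraphs n d).card :=
    Nat.cast_pos.2 (Finset.card_pos.2 (denseGraphs_nonempty hn (by omega)))
  refine le_of_mul_le_mul_left ?_ hpos
  calc ((denseGraphs n d).card : ℝ) * (2 / 3 * L * M)
      = 2 / 3 * (denseGraphs n d).card * L * M := by ring
    _ ≤ ((∑ G ∈ denseGraphs n d, no G : ℕ) : ℝ) * M :=
        mul_le_mul_of_nonneg_right hnosum (Nat.cast_nonneg _)
    _ ≤ _ := hup'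
    _ = _ := by ring

end LocalAlgorithm

/-! ### Choice of constants -/

theorem theorem1 (d : ℕ) (ε δ : ℝ) (hε : 0 ≤ ε) (hεd : 1 + ε < (d : ℝ) / 2)
    (hδ : 0 ≤ δ) (hδ' : δ < 1 / 3) :
    ∃ c : ℝ, 0 < c ∧ ∃ n₀ : ℕ, ∀ n : ℕ, n₀ ≤ n →
      ∀ (Ω : Type*) [MeasurableSpace Ω] (μ : MeasureTheory.Measure Ω)
        [MeasureTheory.IsProbabilityMeasure μ] (A : LocalAlgorithm Ω n d),
        A.IsLocalSparseSpanning μ (connectedGraphs n d) ε δ →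
        ∀ q : ℕ, A.QueryComplexityAtMost μ (connectedGraphs n d) q →
          c * Real.sqrt n ≤ q := by
  have hd2 : (2 : ℝ) < d := by linarith
  have hd : 3 ≤ d := by exact_mod_cast hd2
  have hd3 : (3 : ℝ) ≤ d := by exact_mod_cast hd
  obtain ⟨κ, hκ⟩ : ∃ κ : ℝ, κ = d - 2 * (1 + ε) := ⟨_, rfl⟩
  have hκ0 : 0 < κ := by linarith
  have hden : (0 : ℝ) < 3 * d ^ 4 := by positivity
  -- With `M = n` the quantitative bound reads `2 / 3 * (n κ - d²) ≤ q² d⁴`. The second bound on `n`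
  -- gives `d² ≤ n κ / 2`, so the left side is at least `n κ / 3`, while `q < c √n` and `c ≤ 1` make
  -- the right side smaller than `c n d⁴ ≤ n κ / 3`. The first bound on `n` serves the size
  -- condition `hM`: `144` yields `12 ≤ √n`, hence `12 q ≤ n`.
  refine ⟨min 1 (κ / (3 * d ^ 4)), lt_min one_pos (by positivity),
    max (30 * d + 144) ⌈2 * (d : ℝ) ^ 2 / κ⌉₊, fun n hn Ω _ μ _ A hA q hq => ?_⟩
  set c : ℝ := min 1 (κ / (3 * d ^ 4)) with hc
  have hc0 : 0 < c := lt_min one_pos (by positivity)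
  have hc1 : c ≤ 1 := min_le_left _ _
  have hc2 : c * (3 * d ^ 4) ≤ κ := (le_div_iff₀ hden).1 (min_le_right _ _)
  by_contra! hlt
  have hn1 : 30 * d + 144 ≤ n := (le_max_left _ _).trans hn
  have hn1' : 30 * (d : ℝ) + 144 ≤ n := by exact_mod_cast hn1
  have hn2 : 2 * (d : ℝ) ^ 2 ≤ n * κ := by
    rw [← div_le_iff₀ hκ0]
    exact (Nat.le_ceil _).trans (by exact_mod_cast (le_max_right _ _).trans hn)
  have hn0 : (0 : ℝ) < n := by linarith
  have hs0 : 0 ≤ Real.sqrt n := Real.sqrt_nonneg _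
  have hss : Real.sqrt n * Real.sqrt n = n := Real.mul_self_sqrt hn0.le
  have hs12 : 12 ≤ Real.sqrt n := Real.le_sqrt_of_sq_le (by linarith)
  have hqs : (q : ℝ) ≤ Real.sqrt n := hlt.le.trans (mul_le_of_le_one_left hs0 hc1)
  have hqn : 12 * (q : ℝ) ≤ n := by nlinarith
  have hqn' : 12 * q ≤ n := by exact_mod_cast hqn
  have hM : 2 * n + d * d + 2 * ((q + 2 + 2 * d) * d) ≤ n * d := by
    have h1 : (d + 2 * (q + 2 + 2 * d)) * 3 ≤ n := by omega
    have h2 := Nat.mul_le_mul_right d h1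
    have h3 := Nat.mul_le_mul_left n hd
    nlinarith
  have hL : (n : ℝ) * d - d * d - 2 * ((1 + ε) * n) = n * κ - d ^ 2 := by rw [hκ]; ring
  have hmain := LocalAlgorithm.le_sq_mul_of_isLocalSparseSpanning (by omega) hd hδ'.le hM hA hq
    (by rw [hL]; nlinarith [sq_nonneg (d : ℝ)])
  rw [hL] at hmain
  have hmain' : 2 / 3 * (n * κ - (d : ℝ) ^ 2) ≤ (q : ℝ) * q * d ^ 4 := by
    refine le_of_mul_le_mul_right ?_ hn0
    calc _ ≤ _ := hmain
      _ = _ := by ring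
  have hqq : (q : ℝ) * q < c * n := by
    have h1 : (q : ℝ) * q < c * Real.sqrt n * (c * Real.sqrt n) :=
      mul_self_lt_mul_self (Nat.cast_nonneg q) hlt
    have h2 : c * Real.sqrt n * (c * Real.sqrt n) = c * (c * n) := by
      rw [mul_mul_mul_comm, hss, mul_assoc]
    have h3 : c * (c * n) ≤ c * n := mul_le_of_le_one_left (by positivity) hc1
    linarith
  have hfin : (q : ℝ) * q * d ^ 4 < c * n * d ^ 4 := mul_lt_mul_of_pos_right hqq (by positivity)
  have hcn : c * (3 * (d : ℝ) ^ 4) * n ≤ κ * n := mul_le_mul_of_nonneg_right hc2 hn0.le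
  linarith
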